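/- Let $X=(X_1,\dots,X_d)$ be a multivariate normal random vector with mean $0$ and positive definite covariance matrix $\Sigma=(\sigma_{ij})$ (so that $\sigma_{ii}$ denotes the variance of $X_i$). Suppose that its precision matrix is $\Sigma^{-1}=I+B$, where the (Euclidean) operator norm of $B$ satisfies $\|B\|\le\delta<1$, and put $\epsilon=\frac{\delta}{1-\delta}$. Let $f:\mathbb R\to\mathbb R$ be an odd function which is the sum of its Taylor series at $0$ on all of $\mathbb R$, $f(x)=\sum_{k\ge0}\frac{f^{(k)}(0)}{k!}x^k$, with $|f^{(k)}(0)|\le N$ for all $k\ge 0$. Define $$F_1(x)=\sum_{u\ge 0}\frac{f^{(2u+1)}(0)}{u!}x^u,\qquad G_{1ij}(x)=F_1(\sigma_{ii}x)\,F_1(\sigma_{jj}x).$$ Then every $f(X_i)$ is square integrable and, writing $\tau_{ij}=\operatorname{Cov}(f(X_i),f(X_j))$, for all $i\neq j$ $$\tau_{ij}=G_{1ij}(1/2)\,\sigma_{ij}+O(\epsilon^3),$$ with the explicit bound $$\bigl|\tau_{ij}-G_{1ij}(1/2)\,\sigma_{ij}\bigr|\le \frac{N^2e^{1+\epsilon}\,\epsilon^3\cosh(\epsilon)}{6};$$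 in particular, if $\epsilon<1$, then $\bigl|\tau_{ij}-G_{1ij}(1/2)\,\sigma_{ij}\bigr|\le 2N^2\epsilon^3$. -/

import Mathlib

open MeasureTheory ProbabilityTheory
open scoped Nat

/-- `f` is the sum of its Taylor series at `0` on the whole real line. -/
def IsSumOfTaylorSeries (f : ℝ → ℝ) : Prop :=
  ∀ x : ℝ, HasSum (fun k : ℕ => iteratedDeriv k f 0 / (k ! : ℝ) * x ^ k) (f x)

/-- The series `F_k(x) = ∑_{u ≥ 0} f^{(2u+k)}(0) / u! * x^u`. -/
noncomputable def transF (f : ℝ → ℝ) (k : ℕ) (x : ℝ) : ℝ :=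
  ∑' u : ℕ, iteratedDeriv (2 * u + k) f 0 / (u ! : ℝ) * x ^ u

/-- The series defining `transF` converges when the derivatives of `f` at `0` are bounded. -/
theorem summable_transF {f : ℝ → ℝ} {N : ℝ} (hN : ∀ k : ℕ, |iteratedDeriv k f 0| ≤ N)
    (k : ℕ) (x : ℝ) :
    Summable (fun u : ℕ => iteratedDeriv (2 * u + k) f 0 / (u ! : ℝ) * x ^ u) := by
  refine Summable.of_norm_bounded ((Real.summable_pow_div_factorial |x|).mul_left N) fun u => ?_
  have h : ‖iteratedDeriv (2 * u + k) f 0 / (u ! : ℝ) * x ^ u‖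
      = |iteratedDeriv (2 * u + k) f 0| * (|x| ^ u / (u ! : ℝ)) := by
    rw [norm_mul, norm_div, norm_pow, Real.norm_natCast, Real.norm_eq_abs, Real.norm_eq_abs]
    ring
  rw [h]
  exact mul_le_mul_of_nonneg_right (hN _) (by positivity)

/-- `G_{kij}(x) = F_k(σ_ii x) F_k(σ_jj x)`, where `σ = S` is the covariance matrix. -/
noncomputable def transG {d : ℕ} (f : ℝ → ℝ) (S : Matrix (Fin d) (Fin d) ℝ) (k : ℕ)
    (i j : Fin d) (x : ℝ) : ℝ :=
  transF f k (S i i * x) * transF f k (S j j * x)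

/-- The covariance matrix `τ` of the vector `Y = (f(X_1), …, f(X_d))`. -/
noncomputable def transformedCov {d : ℕ} {Ω : Type*} [MeasurableSpace Ω] (P : Measure Ω)
    (X : Ω → EuclideanSpace ℝ (Fin d)) (f : ℝ → ℝ) : Matrix (Fin d) (Fin d) ℝ :=
  Matrix.of fun i j => cov[fun ω => f (X ω i), fun ω => f (X ω j); P]

/-! The proof is a Mehler-type expansion. The pair `(X i, X j)` has moment generating function `exp
(r s t + α s² + β t²)` with `r = σ_ij`, `α = σ_ii / 2`, `β = σ_jj / 2`. Uniqueness of double power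
series identifies the normalized joint moments with its coefficients. Integrating the product of the
two Taylor series termwise and grouping by powers of `r` gives `τ_ij = ∑ σ_ij^k / k! * G_k(1/2)`
(`hasSum_integral_mul_of_gaussian_mgf`, `hasSum_transformedCov`).

For odd `f` the means and all even `k` vanish, `k = 1` is the main term, and the tail over odd `k ≥
3` is compared with `ε³/6 * cosh ε`. The inputs `σ_ii ≤ 1 + ε` and `|σ_ij| ≤ ε` come from `S - 1 =
-(S * B)`. -/

/-! ### Uniqueness and regrouping of double power series -/

theorem hasSum_real_congr {ι : Type*} {f g : ι → ℝ} {a : ℝ} (h : ∀ i, f i = g i) :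
    HasSum f a ↔ HasSum g a := by
  rw [funext h]

/-- A power series on `[-1, 1]` with vanishing sum has vanishing coefficients. -/
theorem eq_zero_of_hasSum_mul_pow_zero {c : ℕ → ℝ}
    (h : ∀ s : ℝ, |s| ≤ 1 → HasSum (fun n => c n * s ^ n) 0) : c = 0 := by
  have h1 : HasFPowerSeriesAt (fun _ : ℝ => (0 : ℝ)) (FormalMultilinearSeries.ofScalars ℝ c) 0 := by
    rw [hasFPowerSeriesAt_iff]
    filter_upwards [Metric.closedBall_mem_nhds (0 : ℝ) one_pos] with s hs
    simpa [FormalMultilinearSeries.coeff_ofScalars, mul_comm] using h s (by simpa using hs)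
  exact (FormalMultilinearSeries.ofScalars_series_eq_zero ℝ).1 h1.eq_zero

theorem abs_pow_mul_pow_le_one {s t : ℝ} (hs : |s| ≤ 1) (ht : |t| ≤ 1) (p : ℕ × ℕ) :
    |s ^ p.1 * t ^ p.2| ≤ 1 := by
  rw [abs_mul, abs_pow, abs_pow]
  exact mul_le_one₀ (pow_le_one₀ (abs_nonneg _) hs) (by positivity)
    (pow_le_one₀ (abs_nonneg _) ht)

theorem Summable.mul_of_abs_le {ι : Type*} {g w : ι → ℝ} (hg : Summable g) {C : ℝ}
    (hw : ∀ i, |w i| ≤ C) : Summable fun i => g i * w i := by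
  refine Summable.of_norm_bounded (hg.abs.mul_right C) fun i => ?_
  rw [Real.norm_eq_abs, abs_mul]
  exact mul_le_mul_of_nonneg_left (hw i) (abs_nonneg _)

/-- A double power series on `[-1, 1]²` with vanishing sum has vanishing coefficients. -/
theorem eq_zero_of_tsum_mul_pow_mul_pow_eq_zero {e : ℕ × ℕ → ℝ} (he : Summable e)
    (h : ∀ s t : ℝ, |s| ≤ 1 → |t| ≤ 1 → ∑' p, e p * (s ^ p.1 * t ^ p.2) = 0) : e = 0 := by
  have hrow : ∀ m, Summable fun n => e (m, n) := fun m => he.prod_factor m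
  have ht_sum : ∀ m t, |t| ≤ 1 → Summable fun n => e (m, n) * t ^ n := fun m t ht =>
    (hrow m).mul_of_abs_le (C := 1) fun n => by
      rw [abs_pow]; exact pow_le_one₀ (abs_nonneg _) ht
  -- For fixed `t` these are the coefficients of a vanishing power series in `s`; each of them is
  -- then a vanishing power series in `t`.
  have hd : ∀ t : ℝ, |t| ≤ 1 → (fun m => ∑' n, e (m, n) * t ^ n) = 0 := by
    intro t ht
    refine eq_zero_of_hasSum_mul_pow_zero fun s hs => ?_
    have hst := he.mul_of_abs_le (abs_pow_mul_pow_le_one hs ht)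
    have h0 := hst.hasSum
    rw [h s t hs ht] at h0
    refine h0.prod_fiberwise fun m => ?_
    refine (hasSum_real_congr fun n => ?_).2 ((ht_sum m t ht).hasSum.mul_right (s ^ m))
    ring
  funext ⟨m, n⟩
  refine congrFun (eq_zero_of_hasSum_mul_pow_zero (c := fun n => e (m, n)) fun t ht => ?_) n
  have h0 := (ht_sum m t ht).hasSum
  rwa [congrFun (hd t ht) m] at h0

/-- Regrouping a weighted series along the fibres of the map that the weight factors through. -/
theorem hasSum_tsum_fiber_mul {ι κ : Type*} {g : ι → ℝ} (hg : Summable g) (q : ι → κ) {w : κ → ℝ}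
    {C : ℝ} (hw : ∀ p, |w p| ≤ C) :
    HasSum (fun p => (∑' i : q ⁻¹' {p}, g i) * w p) (∑' i, g i * w (q i)) := by
  have h := (hg.mul_of_abs_le fun i => hw (q i)).hasSum.tsum_fiberwise q
  refine (hasSum_real_congr fun p => ?_).2 h
  rw [← tsum_mul_right]
  refine tsum_congr fun i => ?_
  rw [show q i = p from i.2]

/-- Two summable families, one indexed by exponents and one mapped to exponents, that define the
same double power series on `[-1, 1]²` give the same sum for all bounded weights. -/
theorem tsum_mul_eq_tsum_mul_comp {ι : Type*} {c : ℕ × ℕ → ℝ} {g : ι → ℝ} {q : ι → ℕ × ℕ}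
    (hc : Summable c) (hg : Summable g)
    (h : ∀ s t : ℝ, |s| ≤ 1 → |t| ≤ 1 →
      ∑' p, c p * (s ^ p.1 * t ^ p.2) = ∑' i, g i * (s ^ (q i).1 * t ^ (q i).2))
    {w : ℕ × ℕ → ℝ} {C : ℝ} (hw : ∀ p, |w p| ≤ C) :
    ∑' p, c p * w p = ∑' i, g i * w (q i) := by
  have hfib : Summable fun p => ∑' i : q ⁻¹' {p}, g i := by
    simpa using (hasSum_tsum_fiber_mul hg q (w := fun _ => 1) (C := 1) (by simp)).summable
  have hzero := eq_zero_of_tsum_mul_pow_mul_pow_eq_zero (hc.sub hfib) fun s t hs ht => by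
    have hw' := abs_pow_mul_pow_le_one hs ht
    have h1 := (hc.mul_of_abs_le hw').hasSum.sub
      (hasSum_tsum_fiber_mul hg q (w := fun p => s ^ p.1 * t ^ p.2) hw')
    rw [h s t hs ht, sub_self] at h1
    simpa only [sub_mul] using h1.tsum_eq
  rw [← (hasSum_tsum_fiber_mul hg q hw).tsum_eq]
  refine tsum_congr fun p => ?_
  rw [sub_eq_zero.1 (congrFun hzero p)]

theorem Real.hasSum_pow_div_factorial (x : ℝ) :
    HasSum (fun n : ℕ => x ^ n / (n ! : ℝ)) (Real.exp x) := by
  rw [Real.exp_eq_exp_ℝ]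
  exact NormedSpace.expSeries_div_hasSum_exp x

theorem summable_mul_pow_div_factorial {a : ℕ → ℝ} {A : ℝ} (ha : ∀ n, |a n| ≤ A) (x : ℝ) :
    Summable fun n : ℕ => x ^ n / (n ! : ℝ) * a n :=
  (Real.summable_pow_div_factorial x).mul_of_abs_le ha

theorem HasSum.mul_prod_real {ι κ : Type*} {f : ι → ℝ} {g : κ → ℝ} {a b : ℝ} (hf : HasSum f a)
    (hg : HasSum g b) : HasSum (fun p : ι × κ => f p.1 * g p.2) (a * b) :=
  hf.mul hg (summable_mul_of_summable_norm hf.summable.norm hg.summable.norm)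

/-! ### Joint moments and termwise integration -/

section Moments

variable {Ω : Type*} [MeasurableSpace Ω] {P : Measure Ω} {U V : Ω → ℝ}

/-- The exponential of `|U| + |V|` is integrable as soon as the joint moment generating function
is finite at the four points `(±1, ±1)`. -/
theorem integrable_exp_abs_add_abs (hU : AEMeasurable U P) (hV : AEMeasurable V P)
    (h : ∀ s t : ℝ, Integrable (fun ω => Real.exp (s * U ω + t * V ω)) P) :
    Integrable (fun ω => Real.exp |U ω| * Real.exp |V ω|) P := by
  refine Integrable.mono' (((h 1 1).add (h 1 (-1))).add ((h (-1) 1).add (h (-1) (-1)))) ?_ ?_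
  · exact (by fun_prop : AEMeasurable _ P).aestronglyMeasurable
  · refine Filter.Eventually.of_forall fun ω => ?_
    have e := Real.exp_pos
    rw [Real.norm_of_nonneg (by positivity)]
    simp only [Pi.add_apply, Real.exp_add]
    have h1 : Real.exp |U ω| ≤ Real.exp (1 * U ω) + Real.exp (-1 * U ω) := by
      simpa using Real.exp_abs_le (U ω)
    have h2 : Real.exp |V ω| ≤ Real.exp (1 * V ω) + Real.exp (-1 * V ω) := by
      simpa using Real.exp_abs_le (V ω)
    refine (mul_le_mul h1 h2 (e _).le (by positivity)).trans (le_of_eq ?_)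
    ring

/-- The normalized joint moments `E[U^m V^n] / (m! n!)`. -/
noncomputable def jointMoment (P : Measure Ω) (U V : Ω → ℝ) (p : ℕ × ℕ) : ℝ :=
  ∫ ω, (U ω ^ p.1 / (p.1 ! : ℝ)) * (V ω ^ p.2 / (p.2 ! : ℝ)) ∂P

theorem hasSum_jointMoment (hU : AEMeasurable U P) (hV : AEMeasurable V P)
    (hint : Integrable (fun ω => Real.exp |U ω| * Real.exp |V ω|) P)
    {a b : ℕ → ℝ} {A B : ℝ} (ha : ∀ n, |a n| ≤ A) (hb : ∀ n, |b n| ≤ B) {f g : ℝ → ℝ}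
    (hf : ∀ x, HasSum (fun n : ℕ => x ^ n / (n ! : ℝ) * a n) (f x))
    (hg : ∀ x, HasSum (fun n : ℕ => x ^ n / (n ! : ℝ) * b n) (g x)) :
    HasSum (fun p : ℕ × ℕ => jointMoment P U V p * (a p.1 * b p.2))
      (∫ ω, f (U ω) * g (V ω) ∂P) := by
  have hbound : ∀ ω, HasSum (fun p : ℕ × ℕ =>
      (|U ω| ^ p.1 / (p.1 ! : ℝ)) * (|V ω| ^ p.2 / (p.2 ! : ℝ)) * (A * B))
      (Real.exp |U ω| * Real.exp |V ω| * (A * B)) := fun ω =>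
    ((Real.hasSum_pow_div_factorial _).mul_prod_real (Real.hasSum_pow_div_factorial _)).mul_right _
  have key := hasSum_integral_of_dominated_convergence (μ := P)
    (F := fun (p : ℕ × ℕ) ω =>
      (U ω ^ p.1 / (p.1 ! : ℝ)) * (V ω ^ p.2 / (p.2 ! : ℝ)) * (a p.1 * b p.2))
    (f := fun ω => f (U ω) * g (V ω))
    (fun p ω => (|U ω| ^ p.1 / (p.1 ! : ℝ)) * (|V ω| ^ p.2 / (p.2 ! : ℝ)) * (A * B))
    (fun p => (by fun_prop : AEMeasurable _ P).aestronglyMeasurable)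
    (fun p => Filter.Eventually.of_forall fun ω => by
      simp only [Real.norm_eq_abs, abs_mul, abs_div, abs_pow, Nat.abs_cast]
      have hA := (abs_nonneg _).trans (ha p.1)
      gcongr
      exacts [ha _, hb _])
    (Filter.Eventually.of_forall fun ω => (hbound ω).summable)
    (by
      simp only [fun ω => (hbound ω).tsum_eq]
      exact hint.mul_const _)
    (Filter.Eventually.of_forall fun ω => by
      refine (hasSum_real_congr fun p => ?_).2 ((hf (U ω)).mul_prod_real (hg (V ω)))
      ring)
  refine (hasSum_real_congr fun p => ?_).2 key
  rw [jointMoment, integral_mul_const]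

theorem summable_jointMoment (hU : AEMeasurable U P) (hV : AEMeasurable V P)
    (hint : Integrable (fun ω => Real.exp |U ω| * Real.exp |V ω|) P) :
    Summable (jointMoment P U V) := by
  -- With all coefficients equal to `1`, both functions are `exp` and the weighted series is the
  -- series of moments itself.
  have h := hasSum_jointMoment hU hV hint (a := fun _ => 1) (b := fun _ => 1) (A := 1) (B := 1)
    (by simp) (by simp) (f := Real.exp) (g := Real.exp)
    (by simpa using Real.hasSum_pow_div_factorial) (by simpa using Real.hasSum_pow_div_factorial)
  simpa using h.summable

end Moments

/-! ### The expansion in powers of the covariance -/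

/-- The coefficients of `exp (r s t + α s² + β t²)`. -/
noncomputable def gaussianCoeff (r α β : ℝ) (i : ℕ × ℕ × ℕ) : ℝ :=
  r ^ i.1 / (i.1 ! : ℝ) * (α ^ i.2.1 / (i.2.1 ! : ℝ) * (β ^ i.2.2 / (i.2.2 ! : ℝ)))

/-- The exponents belonging to the coefficients `gaussianCoeff`. -/
def gaussianExponent (i : ℕ × ℕ × ℕ) : ℕ × ℕ := (2 * i.2.1 + i.1, 2 * i.2.2 + i.1)

theorem summable_gaussianCoeff (r α β : ℝ) : Summable (gaussianCoeff r α β) :=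
  ((Real.hasSum_pow_div_factorial r).mul_prod_real
    ((Real.hasSum_pow_div_factorial α).mul_prod_real (Real.hasSum_pow_div_factorial β))).summable

theorem hasSum_gaussianCoeff (r α β s t : ℝ) :
    HasSum (fun i => gaussianCoeff r α β i *
        (s ^ (gaussianExponent i).1 * t ^ (gaussianExponent i).2))
      (Real.exp (r * (s * t) + (α * s ^ 2 + β * t ^ 2))) := by
  rw [Real.exp_add, Real.exp_add]
  refine (hasSum_real_congr fun i => ?_).2
    ((Real.hasSum_pow_div_factorial (r * (s * t))).mul_prod_real
    ((Real.hasSum_pow_div_factorial (α * s ^ 2)).mul_prod_real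
      (Real.hasSum_pow_div_factorial (β * t ^ 2))))
  simp only [gaussianCoeff, gaussianExponent, mul_pow, pow_add, pow_mul]
  ring

/-- Mehler-type expansion: the expectation of `f(U) g(V)` for a pair with a centred Gaussian joint
moment generating function. -/
theorem hasSum_integral_mul_of_gaussian_mgf {Ω : Type*} [MeasurableSpace Ω] {P : Measure Ω}
    {U V : Ω → ℝ} (hU : AEMeasurable U P) (hV : AEMeasurable V P) {r α β : ℝ}
    (hint : ∀ s t : ℝ, Integrable (fun ω => Real.exp (s * U ω + t * V ω)) P)
    (hmgf : ∀ s t : ℝ, ∫ ω, Real.exp (s * U ω + t * V ω) ∂P =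
      Real.exp (r * (s * t) + (α * s ^ 2 + β * t ^ 2)))
    {a b : ℕ → ℝ} {A B : ℝ} (ha : ∀ n, |a n| ≤ A) (hb : ∀ n, |b n| ≤ B) {f g : ℝ → ℝ}
    (hf : ∀ x, HasSum (fun n : ℕ => x ^ n / (n ! : ℝ) * a n) (f x))
    (hg : ∀ x, HasSum (fun n : ℕ => x ^ n / (n ! : ℝ) * b n) (g x)) :
    HasSum (fun k : ℕ => r ^ k / (k ! : ℝ) *
        ((∑' u : ℕ, α ^ u / (u ! : ℝ) * a (2 * u + k)) *
          ∑' v : ℕ, β ^ v / (v ! : ℝ) * b (2 * v + k)))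
      (∫ ω, f (U ω) * g (V ω) ∂P) := by
  have hexp := integrable_exp_abs_add_abs hU hV hint
  have hA := (abs_nonneg _).trans (ha 0)
  have hw : ∀ p : ℕ × ℕ, |a p.1 * b p.2| ≤ A * B := fun p => by
    rw [abs_mul]; exact mul_le_mul (ha _) (hb _) (abs_nonneg _) hA
  have heq := tsum_mul_eq_tsum_mul_comp (summable_jointMoment hU hV hexp)
    (summable_gaussianCoeff r α β) (q := gaussianExponent) (fun s t hs ht => by
      rw [(hasSum_gaussianCoeff r α β s t).tsum_eq, ← hmgf]
      -- The coefficients `s ^ n` and `t ^ n`, bounded because `|s|, |t| ≤ 1`, turn the moment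
      -- series into the moment generating function.
      have hpow : ∀ {z : ℝ}, |z| ≤ 1 → ∀ n : ℕ, |z ^ n| ≤ 1 := fun hz n => by
        rw [abs_pow]; exact pow_le_one₀ (abs_nonneg _) hz
      have hser : ∀ z x : ℝ, HasSum (fun n : ℕ => x ^ n / (n ! : ℝ) * z ^ n) (Real.exp (z * x)) :=
        fun z x => by
          refine (hasSum_real_congr fun n => ?_).2 (Real.hasSum_pow_div_factorial (z * x))
          rw [mul_pow]; ring
      rw [(hasSum_jointMoment hU hV hexp (hpow hs) (hpow ht) (hser s) (hser t)).tsum_eq]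
      simp only [Real.exp_add]) hw
  rw [← (hasSum_jointMoment hU hV hexp ha hb hf hg).tsum_eq, heq]
  have hsum := ((summable_gaussianCoeff r α β).mul_of_abs_le
    fun i => hw (gaussianExponent i)).hasSum
  -- For a fixed power `k` of `r`, the remaining double sum over `(u, v)` factors.
  refine hsum.prod_fiberwise fun k => ?_
  have h1 := summable_mul_pow_div_factorial (fun u => ha (2 * u + k)) α
  have h2 := summable_mul_pow_div_factorial (fun v => hb (2 * v + k)) β
  refine (hasSum_real_congr fun i => ?_).2
    ((h1.hasSum.mul_prod_real h2.hasSum).mul_left (r ^ k / (k ! : ℝ)))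
  simp only [gaussianCoeff, gaussianExponent]
  ring

/-! ### Moment generating function of two Gaussian coordinates -/

section GaussianLaw

variable {d : ℕ} {Ω : Type*} [MeasurableSpace Ω] {P : Measure Ω}
  {X : Ω → EuclideanSpace ℝ (Fin d)} {S : Matrix (Fin d) (Fin d) ℝ}

theorem ProbabilityTheory.HasLaw.aemeasurable_eval (hX : HasLaw X (multivariateGaussian 0 S) P)
    (i : Fin d) : AEMeasurable (fun ω => X ω i) P := by
  have := hX.aemeasurable
  fun_prop

theorem map_linear_combination_multivariateGaussian (hS : S.PosSemidef) (i j : Fin d) (s t : ℝ) :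
    (multivariateGaussian 0 S).map (fun x => s * x i + t * x j) =
      gaussianReal 0 (s ^ 2 * S i i + 2 * (s * t) * S i j + t ^ 2 * S j j).toNNReal := by
  set μ := multivariateGaussian (0 : EuclideanSpace ℝ (Fin d)) S with hμ
  let L : StrongDual ℝ (EuclideanSpace ℝ (Fin d)) :=
    s • EuclideanSpace.proj i + t • EuclideanSpace.proj j
  have hL : (fun x : EuclideanSpace ℝ (Fin d) => s * x i + t * x j) = L := by
    ext x; simp [L]
  have hmem : ∀ k : Fin d, MemLp (fun x : EuclideanSpace ℝ (Fin d) => x k) 2 μ := fun k =>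
    IsGaussian.memLp_dual μ (EuclideanSpace.proj k) 2 (by simp)
  have hmean : ∫ x, L x ∂μ = 0 := by
    rw [L.integral_comp_id_comm IsGaussian.integrable_id, hμ, integral_id_multivariateGaussian,
      map_zero]
  have hvar : Var[L; μ] = s ^ 2 * S i i + 2 * (s * t) * S i j + t ^ 2 * S j j := by
    rw [← hL]
    rw [variance_fun_add ((hmem i).const_mul s) ((hmem j).const_mul t),
      variance_const_mul, variance_const_mul, covariance_const_mul_left,
      covariance_const_mul_right, hμ, variance_eval_multivariateGaussian hS,
      variance_eval_multivariateGaussian hS, covariance_eval_multivariateGaussian hS]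
    ring
  rw [hL, IsGaussian.map_eq_gaussianReal, hmean, hvar]

theorem ProbabilityTheory.HasLaw.map_linear_combination
    (hX : HasLaw X (multivariateGaussian 0 S) P) (hS : S.PosSemidef) (i j : Fin d) (s t : ℝ) :
    P.map (fun ω => s * X ω i + t * X ω j) =
      gaussianReal 0 (s ^ 2 * S i i + 2 * (s * t) * S i j + t ^ 2 * S j j).toNNReal := by
  rw [← map_linear_combination_multivariateGaussian hS, ← hX.map_eq,
    AEMeasurable.map_map_of_aemeasurable (by fun_prop) hX.aemeasurable]
  rfl

/-- This is the quadratic form of `S` at `s e_i + t e_j`; it ensures that `toNNReal` truncates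
nothing. -/
theorem linear_combination_variance_nonneg (hS : S.PosSemidef) (i j : Fin d) (s t : ℝ) :
    0 ≤ s ^ 2 * S i i + 2 * (s * t) * S i j + t ^ 2 * S j j := by
  have h := hS.dotProduct_mulVec_nonneg (s • Pi.single i 1 + t • Pi.single j 1)
  have hsymm : S j i = S i j := by simpa using hS.isHermitian.apply i j
  simp only [star_trivial, Matrix.mulVec_add, Matrix.mulVec_smul, add_dotProduct, dotProduct_add,
    smul_dotProduct, dotProduct_smul, Matrix.mulVec_single_one, single_one_dotProduct,
    Matrix.col_apply, smul_eq_mul, hsymm] at h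
  linarith

theorem integrable_exp_linear_combination (hX : HasLaw X (multivariateGaussian 0 S) P)
    (hS : S.PosSemidef) (i j : Fin d) (s t : ℝ) :
    Integrable (fun ω => Real.exp (s * X ω i + t * X ω j)) P := by
  have h := hX.map_linear_combination hS i j s t
  have h1 := integrable_exp_mul_gaussianReal (μ := 0)
    (v := (s ^ 2 * S i i + 2 * (s * t) * S i j + t ^ 2 * S j j).toNNReal) 1
  have hm : AEMeasurable (fun ω => s * X ω i + t * X ω j) P :=
    ((hX.aemeasurable_eval i).const_mul s).add ((hX.aemeasurable_eval j).const_mul t)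
  rw [← h] at h1
  simpa [Function.comp_def] using h1.comp_aemeasurable hm

theorem integral_exp_linear_combination (hX : HasLaw X (multivariateGaussian 0 S) P)
    (hS : S.PosSemidef) (i j : Fin d) (s t : ℝ) :
    ∫ ω, Real.exp (s * X ω i + t * X ω j) ∂P =
      Real.exp (S i j * (s * t) + (S i i * (1 / 2) * s ^ 2 + S j j * (1 / 2) * t ^ 2)) := by
  have h := mgf_gaussianReal (hX.map_linear_combination hS i j s t) 1
  rw [Real.coe_toNNReal _ (linear_combination_variance_nonneg hS i j s t)] at h
  simp only [mgf, one_mul] at h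
  rw [h]
  congr 1
  ring

end GaussianLaw

/-! ### Entries of the covariance matrix from the precision matrix -/

section Precision

variable {n : Type*} [Fintype n] [DecidableEq n]

/-- The entry is coordinate `i` of the image of the unit vector `e_j`. -/
theorem Matrix.abs_apply_le_norm_toEuclideanCLM (A : Matrix n n ℝ) (i j : n) :
    |A i j| ≤ ‖Matrix.toEuclideanCLM (n := n) (𝕜 := ℝ) A‖ := by
  set T := Matrix.toEuclideanCLM (n := n) (𝕜 := ℝ) A with hT
  have h := (PiLp.norm_apply_le (T (EuclideanSpace.single j 1)) i).trans (T.le_opNorm _)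
  simpa [hT, Matrix.ofLp_toEuclideanCLM] using h

/-- Since `S - 1 = -(S * B)`, one gets `‖S‖ ≤ 1 + δ ‖S‖`, which is solved for `‖S‖` and fed back
into `‖S - 1‖ ≤ δ ‖S‖`. -/
theorem Matrix.norm_toEuclideanCLM_inv_le {S B : Matrix n n ℝ} (hS : IsUnit S) {δ : ℝ}
    (hprec : S⁻¹ = 1 + B) (hB : ‖Matrix.toEuclideanCLM (n := n) (𝕜 := ℝ) B‖ ≤ δ) (hδ : δ < 1) :
    ‖Matrix.toEuclideanCLM (n := n) (𝕜 := ℝ) S‖ ≤ 1 / (1 - δ) ∧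
      ‖Matrix.toEuclideanCLM (n := n) (𝕜 := ℝ) (S - 1)‖ ≤ δ / (1 - δ) := by
  have hmul : S * (1 + B) = 1 := by
    rw [← hprec]; exact Matrix.mul_nonsing_inv _ ((Matrix.isUnit_iff_isUnit_det S).1 hS)
  have hsub : S - 1 = -(S * B) := by
    rw [mul_add, mul_one] at hmul
    rw [← hmul]; abel
  have hpos : 0 < 1 - δ := by linarith
  set T := Matrix.toEuclideanCLM (n := n) (𝕜 := ℝ) S
  have hle : ‖Matrix.toEuclideanCLM (n := n) (𝕜 := ℝ) (S - 1)‖ ≤ ‖T‖ * δ := by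
    rw [hsub, map_neg, map_mul, norm_neg]
    exact (norm_mul_le _ _).trans (mul_le_mul_of_nonneg_left hB (norm_nonneg _))
  have hT : ‖T‖ ≤ 1 / (1 - δ) := by
    have h1 : T = 1 + Matrix.toEuclideanCLM (n := n) (𝕜 := ℝ) (S - 1) := by
      rw [map_sub, map_one]; abel
    have h2 : ‖T‖ ≤ 1 + ‖T‖ * δ := by
      calc ‖T‖ = ‖1 + Matrix.toEuclideanCLM (n := n) (𝕜 := ℝ) (S - 1)‖ := by rw [← h1]
        _ ≤ _ := (norm_add_le _ _).trans
          (add_le_add ContinuousLinearMap.norm_id_le hle)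
    rw [le_div_iff₀ hpos]
    linarith
  refine ⟨hT, hle.trans ?_⟩
  rw [div_eq_mul_one_div, mul_comm]
  exact mul_le_mul_of_nonneg_left hT ((norm_nonneg _).trans hB)

end Precision

/-! ### Taylor series of `f` and the functions `F_k` -/

section Transform

variable {f : ℝ → ℝ} {N : ℝ}

theorem Function.Odd.iteratedDeriv_even_zero (hf : Function.Odd f) {n : ℕ} (hn : Even n) :
    iteratedDeriv n f 0 = 0 := by
  have h := iteratedDeriv_comp_neg n f 0
  rw [show (fun x => f (-x)) = fun x => -f x from funext hf, iteratedDeriv_fun_neg, hn.neg_one_pow,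
    neg_zero, one_smul] at h
  linarith

theorem IsSumOfTaylorSeries.hasSum (hf : IsSumOfTaylorSeries f) (x : ℝ) :
    HasSum (fun n : ℕ => x ^ n / (n ! : ℝ) * iteratedDeriv n f 0) (f x) :=
  (hasSum_real_congr fun n => by ring).2 (hf x)

theorem IsSumOfTaylorSeries.measurable (hf : IsSumOfTaylorSeries f) : Measurable f :=
  measurable_of_tendsto_metrizable
    (f := fun n x => ∑ k ∈ Finset.range n, x ^ k / (k ! : ℝ) * iteratedDeriv k f 0)
    (fun n => by fun_prop) (tendsto_pi_nhds.2 fun x => (hf.hasSum x).tendsto_sum_nat)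

theorem IsSumOfTaylorSeries.abs_le (hf : IsSumOfTaylorSeries f)
    (hN : ∀ k : ℕ, |iteratedDeriv k f 0| ≤ N) (x : ℝ) : |f x| ≤ Real.exp |x| * N := by
  rw [← (hf.hasSum x).tsum_eq, ← Real.norm_eq_abs]
  refine tsum_of_norm_bounded ((Real.hasSum_pow_div_factorial |x|).mul_right N) fun n => ?_
  rw [Real.norm_eq_abs, abs_mul, abs_div, abs_pow, Nat.abs_cast]
  exact mul_le_mul_of_nonneg_left (hN n) (by positivity)

theorem transF_eq (f : ℝ → ℝ) (k : ℕ) (x : ℝ) :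
    transF f k x = ∑' u : ℕ, x ^ u / (u ! : ℝ) * iteratedDeriv (2 * u + k) f 0 :=
  tsum_congr fun u => by ring

theorem abs_transF_le (hN : ∀ k : ℕ, |iteratedDeriv k f 0| ≤ N) (k : ℕ) {x : ℝ} (hx : 0 ≤ x) :
    |transF f k x| ≤ N * Real.exp x := by
  rw [transF_eq, mul_comm, ← Real.norm_eq_abs]
  refine tsum_of_norm_bounded ((Real.hasSum_pow_div_factorial x).mul_right N) fun n => ?_
  rw [Real.norm_eq_abs, abs_mul, abs_of_nonneg (by positivity)]
  exact mul_le_mul_of_nonneg_left (hN _) (by positivity)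

theorem transF_even_of_odd (hf : Function.Odd f) {k : ℕ} (hk : Even k) (x : ℝ) :
    transF f k x = 0 := by
  rw [transF_eq]
  simp [fun u : ℕ => hf.iteratedDeriv_even_zero ((even_two_mul u).add hk)]

end Transform

/-! ### Covariance expansion and tail estimate -/

section Covariance

variable {d : ℕ} {Ω : Type*} [MeasurableSpace Ω] {P : Measure Ω}
  {X : Ω → EuclideanSpace ℝ (Fin d)} {S : Matrix (Fin d) (Fin d) ℝ} {f : ℝ → ℝ} {N : ℝ}

theorem memLp_two_comp_gaussian (hX : HasLaw X (multivariateGaussian 0 S) P)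
    (hS : S.PosSemidef) (hf : IsSumOfTaylorSeries f) (hN : ∀ k : ℕ, |iteratedDeriv k f 0| ≤ N)
    (i : Fin d) : MemLp (fun ω => f (X ω i)) 2 P := by
  have hm := hX.aemeasurable_eval i
  have hfm : AEStronglyMeasurable (fun ω => f (X ω i)) P :=
    (hf.measurable.comp_aemeasurable hm).aestronglyMeasurable
  rw [memLp_two_iff_integrable_sq hfm]
  have hint := integrable_exp_abs_add_abs hm hm (integrable_exp_linear_combination hX hS i i)
  refine (hint.mul_const (N ^ 2)).mono' (hfm.pow 2) (Filter.Eventually.of_forall fun ω => ?_)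
  rw [norm_pow, Real.norm_eq_abs]
  refine (pow_le_pow_left₀ (abs_nonneg _) (hf.abs_le hN _) 2).trans (le_of_eq ?_)
  ring

theorem integral_comp_gaussian_eq_zero (hX : HasLaw X (multivariateGaussian 0 S) P)
    (hS : S.PosSemidef) (hf_odd : Function.Odd f) (hf : IsSumOfTaylorSeries f)
    (hN : ∀ k : ℕ, |iteratedDeriv k f 0| ≤ N) (i : Fin d) : ∫ ω, f (X ω i) ∂P = 0 := by
  -- The expansion is used with `g = 1`: the terms `k > 0` lose their second factor, and `k = 0`
  -- contains `F_0 = 0`.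
  have h := hasSum_integral_mul_of_gaussian_mgf (hX.aemeasurable_eval i) (hX.aemeasurable_eval i)
    (integrable_exp_linear_combination hX hS i i) (integral_exp_linear_combination hX hS i i)
    hN (b := fun n => if n = 0 then 1 else 0) (B := 1) (fun n => by split_ifs <;> simp)
    hf.hasSum (g := fun _ => 1) (fun x => by
      have h0 := hasSum_ite_eq (0 : ℕ) (1 : ℝ)
      refine (hasSum_real_congr fun n => ?_).2 h0
      by_cases hn : n = 0 <;> simp [hn])
  simp only [mul_one] at h
  refine h.unique ((hasSum_real_congr fun k => ?_).2 hasSum_zero)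
  rw [← transF_eq]
  rcases Nat.eq_zero_or_pos k with rfl | hk
  · simp [transF_even_of_odd hf_odd]
  · simp [hk.ne']

theorem hasSum_transformedCov [IsProbabilityMeasure P]
    (hX : HasLaw X (multivariateGaussian 0 S) P) (hS : S.PosSemidef) (hf_odd : Function.Odd f)
    (hf : IsSumOfTaylorSeries f) (hN : ∀ k : ℕ, |iteratedDeriv k f 0| ≤ N) (i j : Fin d) :
    HasSum (fun k : ℕ => S i j ^ k / (k ! : ℝ) * transG f S k i j (1 / 2))
      (transformedCov P X f i j) := by
  have hcov : transformedCov P X f i j = ∫ ω, f (X ω i) * f (X ω j) ∂P := by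
    rw [transformedCov, Matrix.of_apply, covariance_eq_sub (memLp_two_comp_gaussian hX hS hf hN i)
      (memLp_two_comp_gaussian hX hS hf hN j),
      integral_comp_gaussian_eq_zero hX hS hf_odd hf hN i, zero_mul, sub_zero]
    rfl
  rw [hcov]
  refine (hasSum_real_congr fun k => ?_).2 (hasSum_integral_mul_of_gaussian_mgf
    (hX.aemeasurable_eval i) (hX.aemeasurable_eval j) (integrable_exp_linear_combination hX hS i j)
    (integral_exp_linear_combination hX hS i j) hN hN hf.hasSum hf.hasSum)
  rw [transG, transF_eq, transF_eq]

/-- The extra factor `(2j+1)(2j+2)(2j+3)` is at least `6`; this compares the tail with the series of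
`cosh`. -/
theorem six_mul_factorial_le (j : ℕ) : 6 * ((2 * j) ! : ℝ) ≤ ((2 * j + 3) ! : ℝ) := by
  have h : 6 * (2 * j) ! ≤ (2 * j + 3) ! := by
    simp only [Nat.factorial_succ, ← mul_assoc]
    exact Nat.mul_le_mul_right _ (by ring_nf; omega)
  exact_mod_cast h

theorem abs_pow_div_factorial_le {r ε : ℝ} (hr : |r| ≤ ε) (j : ℕ) :
    |r ^ (2 * j + 3) / ((2 * j + 3) ! : ℝ)| ≤ ε ^ 3 / 6 * (ε ^ (2 * j) / ((2 * j) ! : ℝ)) := by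
  have hε := (abs_nonneg r).trans hr
  rw [abs_div, abs_pow, Nat.abs_cast]
  calc |r| ^ (2 * j + 3) / ((2 * j + 3) ! : ℝ) ≤ ε ^ (2 * j + 3) / (6 * ((2 * j) ! : ℝ)) := by
        gcongr
        exact six_mul_factorial_le j
    _ = _ := by rw [pow_add]; field_simp

theorem abs_transformedCov_sub_le [IsProbabilityMeasure P]
    (hX : HasLaw X (multivariateGaussian 0 S) P) (hS : S.PosSemidef) (hf_odd : Function.Odd f)
    (hf : IsSumOfTaylorSeries f) (hN : ∀ k : ℕ, |iteratedDeriv k f 0| ≤ N) {i j : Fin d} {ε : ℝ}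
    (hii : S i i ≤ 1 + ε) (hjj : S j j ≤ 1 + ε) (hij : |S i j| ≤ ε) :
    |transformedCov P X f i j - transG f S 1 i j (1 / 2) * S i j|
      ≤ N ^ 2 * Real.exp (1 + ε) * ε ^ 3 * Real.cosh ε / 6 := by
  have hε := (abs_nonneg _).trans hij
  have hN0 := (abs_nonneg _).trans (hN 0)
  have hG : ∀ k, |transG f S k i j (1 / 2)| ≤ N ^ 2 * Real.exp (1 + ε) := fun k => by
    have hi : 0 ≤ S i i * (1 / 2) := mul_nonneg hS.diag_nonneg (by norm_num)
    have hj : 0 ≤ S j j * (1 / 2) := mul_nonneg hS.diag_nonneg (by norm_num)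
    rw [transG, abs_mul]
    calc _ ≤ (N * Real.exp (S i i * (1 / 2))) * (N * Real.exp (S j j * (1 / 2))) :=
          mul_le_mul (abs_transF_le hN k hi) (abs_transF_le hN k hj) (abs_nonneg _) (by positivity)
      _ = N ^ 2 * Real.exp (S i i * (1 / 2) + S j j * (1 / 2)) := by rw [Real.exp_add]; ring
      _ ≤ _ := mul_le_mul_of_nonneg_left (Real.exp_le_exp.2 (by linarith)) (by positivity)
  have hsum := hasSum_transformedCov hX hS hf_odd hf hN i j
  have hinj : Function.Injective fun m : ℕ => 2 * m + 1 := fun a b h => by simpa using h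
  rw [← hinj.hasSum_iff fun k hk => by
    have hev : Even k := by
      by_contra hodd
      obtain ⟨m, hm⟩ := Nat.not_even_iff_odd.1 hodd
      exact hk ⟨m, hm.symm⟩
    rw [transG, transF_even_of_odd hf_odd hev, zero_mul, mul_zero]] at hsum
  -- Only odd `k = 2m + 1` remain; removing `m = 0` removes the main term, and the shift makes the
  -- exponents `2m + 3`.
  have htail := (hasSum_nat_add_iff' 1).2 hsum
  have heq : transformedCov P X f i j - transG f S 1 i j (1 / 2) * S i j =
      ∑' m : ℕ, S i j ^ (2 * m + 3) / ((2 * m + 3) ! : ℝ) * transG f S (2 * m + 3) i j (1 / 2) := by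
    have h0 := htail.tsum_eq
    simp only [Function.comp_apply, Finset.range_one, Finset.sum_singleton, mul_zero, zero_add,
      pow_one, Nat.factorial_one, Nat.cast_one, div_one] at h0
    rw [mul_comm (transG f S 1 i j (1 / 2)), ← h0]
    exact tsum_congr fun m => by rw [show 2 * (m + 1) + 1 = 2 * m + 3 by ring]
  rw [heq, ← Real.norm_eq_abs, show N ^ 2 * Real.exp (1 + ε) * ε ^ 3 * Real.cosh ε / 6 =
    ε ^ 3 / 6 * Real.cosh ε * (N ^ 2 * Real.exp (1 + ε)) by ring]
  refine tsum_of_norm_bounded (((Real.hasSum_cosh ε).mul_left (ε ^ 3 / 6)).mul_right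
    (N ^ 2 * Real.exp (1 + ε))) fun m => ?_
  rw [Real.norm_eq_abs, abs_mul]
  exact mul_le_mul (abs_pow_div_factorial_le hij m) (hG _) (abs_nonneg _) (by positivity)

end Covariance

/-! ### Numerical constant and conclusion -/

/-- By monotonicity the worst case is `ε = 1`, with value `(e³ + e) / 2 < 11.5`; the bound `12`
divided by `6` gives the constant `2`. -/
theorem exp_one_add_mul_cosh_le {ε : ℝ} (h0 : 0 ≤ ε) (h1 : ε ≤ 1) :
    Real.exp (1 + ε) * Real.cosh ε ≤ 12 := by
  have he : Real.exp 1 ≤ 2.72 := Real.exp_one_lt_d9.le.trans (by norm_num)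
  have hp := Real.exp_pos 1
  have hcosh : Real.cosh ε ≤ Real.cosh 1 :=
    Real.cosh_le_cosh.2 (by rw [abs_of_nonneg h0, abs_one]; exact h1)
  calc Real.exp (1 + ε) * Real.cosh ε ≤ Real.exp (1 + 1) * Real.cosh 1 := by gcongr
    _ = (Real.exp 1 ^ 3 + Real.exp 1) / 2 := by
        rw [Real.cosh_eq, Real.exp_add, Real.exp_neg]; field_simp
    _ ≤ (2.72 ^ 3 + 2.72) / 2 := by gcongr
    _ ≤ 12 := by norm_num

theorem mainTheorem3 {d : ℕ} {Ω : Type*} [MeasurableSpace Ω]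
    (P : Measure Ω) [IsProbabilityMeasure P]
    (X : Ω → EuclideanSpace ℝ (Fin d)) (S B : Matrix (Fin d) (Fin d) ℝ)
    (hS : S.PosDef) (hX : HasLaw X (multivariateGaussian 0 S) P)
    (f : ℝ → ℝ) (hf_odd : Function.Odd f) (hf_taylor : IsSumOfTaylorSeries f)
    (N : ℝ) (hN : ∀ k : ℕ, |iteratedDeriv k f 0| ≤ N)
    (hprec : S⁻¹ = 1 + B)
    (δ ε : ℝ) (hB : ‖Matrix.toEuclideanCLM (𝕜 := ℝ) B‖ ≤ δ) (hδ : δ < 1)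
    (hε : ε = δ / (1 - δ)) :
    (∀ i : Fin d, MemLp (fun ω => f (X ω i)) 2 P) ∧
    ∀ i j : Fin d, i ≠ j →
      |transformedCov P X f i j - transG f S 1 i j (1 / 2) * S i j|
          ≤ N ^ 2 * Real.exp (1 + ε) * ε ^ 3 * Real.cosh ε / 6 ∧
      (ε < 1 →
        |transformedCov P X f i j - transG f S 1 i j (1 / 2) * S i j|
          ≤ 2 * N ^ 2 * ε ^ 3) := by
  refine ⟨memLp_two_comp_gaussian hX hS.posSemidef hf_taylor hN, fun i j hij => ?_⟩
  obtain ⟨hnorm, hnorm_sub⟩ := Matrix.norm_toEuclideanCLM_inv_le hS.isUnit hprec hB hδ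
  have hpos : 0 < 1 - δ := by linarith
  have hε1 : 1 / (1 - δ) = 1 + ε := by rw [hε]; field_simp; ring
  have hdiag : ∀ k, S k k ≤ 1 + ε := fun k =>
    (le_abs_self _).trans ((S.abs_apply_le_norm_toEuclideanCLM k k).trans (hε1 ▸ hnorm))
  have hoff : |S i j| ≤ ε := by
    have h := ((S - 1).abs_apply_le_norm_toEuclideanCLM i j).trans hnorm_sub
    rwa [Matrix.sub_apply, Matrix.one_apply_ne hij, sub_zero, ← hε] at h
  have hε0 : 0 ≤ ε := (abs_nonneg _).trans hoff
  have hmain := abs_transformedCov_sub_le hX hS.posSemidef hf_odd hf_taylor hN (hdiag i) (hdiag j)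
    hoff
  refine ⟨hmain, fun hlt => hmain.trans ?_⟩
  have hc := exp_one_add_mul_cosh_le hε0 hlt.le
  calc N ^ 2 * Real.exp (1 + ε) * ε ^ 3 * Real.cosh ε / 6
      = N ^ 2 * ε ^ 3 * (Real.exp (1 + ε) * Real.cosh ε) / 6 := by ring
    _ ≤ N ^ 2 * ε ^ 3 * 12 / 6 := by gcongr
    _ = 2 * N ^ 2 * ε ^ 3 := by ring
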